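/- All spaces below are Hausdorff where they are called paracompact or of dimension at most $n$. A partition of unity on a space $X$ is a family $\{f_s\}_{s\in S}$ of continuous functions $f_s:X\to[0,\infty)$ with $\sum_{s\in S}f_s(x)=1$ for every $x\in X$ (no finiteness condition is imposed); its order is at most $n$ if for each $x\in X$ at most $n+1$ of the numbers $f_s(x)$ are positive. A Hausdorff space $X$ is paracompact if for every open cover $\{U_s\}_{s\in S}$ of $X$ there is a partition of unity $\{f_s\}_{s\in S}$ on $X$ such that $f_s$ vanishes on $X\setminus U_s$ for each $s\in S$. For an integer $n\ge -1$, $\dim(X)\le n$ means that $X$ is Hausdorff and that such a partition of unity of order at most $n$ exists for every open cover of $X$ (so $\dim(X)\le -1$ means that $X$ is empty). **Proposition 0.14.** Let $A$ be a closed subset of a topological space $X$, let $f:A\to Y$ be a continuous function, and let $X\cup_f Y$ be the adjunction space, that is, the quotient space of the disjoint union $X\oplus Y$ under the identification $x\sim f(x)$ for all $x\in A$. If $X$ and $Y$ are paracompact, then $X\cup_f Y$ is paracompact. If moreover $n\ge -1$ is an integer with $\dim(X)\le n$ and $\dim(Y)\le n$, then $\dim(X\cup_f Y)\le n$. -/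

import Mathlib

universe u v w

/-- A partition of unity on `X`, indexed by `S`: a family of continuous functions `X → [0, ∞)` whose
pointwise sum is `1`. No local or point finiteness is required: for nonnegative families, `HasSum`
to `1` says that the supremum of the finite partial sums is `1`. -/
structure IsPartitionOfUnity {S : Type w} {X : Type u} [TopologicalSpace X] (f : S → X → ℝ) :
    Prop where
  continuous : ∀ s, Continuous (f s)
  nonneg : ∀ s x, 0 ≤ f s x
  hasSum_one : ∀ x, HasSum (fun s => f s x) 1

/-- The family `f` is small with respect to the family of sets `U`: each `f s` vanishes off `U s`. -/
def IsSmall {S : Type w} {X : Type u} (f : S → X → ℝ) (U : S → Set X) : Prop :=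
  ∀ s, ∀ x, x ∉ U s → f s x = 0

/-- The family `f` has order at most `n`: at each point at most `n + 1` of its members are
positive. -/
def OrderLE {S : Type w} {X : Type u} (f : S → X → ℝ) (n : ℤ) : Prop :=
  ∀ x, {s | 0 < f s x}.Finite ∧ (({s | 0 < f s x}.ncard : ℕ) : ℤ) ≤ n + 1

/-- A Hausdorff space is paracompact if every open cover `U`, indexed by any set, admits a
partition of unity that is small with respect to it. (Index types in the universe of `X` suffice,
because a cover has at most as many distinct members as there are subsets of `X`.) -/
def IsParacompactHausdorff (X : Type u) [TopologicalSpace X] : Prop :=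
  T2Space X ∧ ∀ (S : Type u) (U : S → Set X), (∀ s, IsOpen (U s)) → (⋃ s, U s) = Set.univ →
    ∃ f : S → X → ℝ, IsPartitionOfUnity f ∧ IsSmall f U

/-- `dim X ≤ n` (covering dimension), to be used for `n ≥ -1`: `X` is Hausdorff and every open
cover `U` admits a partition of unity of order at most `n` that is small with respect to it.
For `n = -1` this says that `X` is empty. -/
def DimLE (X : Type u) [TopologicalSpace X] (n : ℤ) : Prop :=
  T2Space X ∧ ∀ (S : Type u) (U : S → Set X), (∀ s, IsOpen (U s)) → (⋃ s, U s) = Set.univ →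
    ∃ f : S → X → ℝ, IsPartitionOfUnity f ∧ OrderLE f n ∧ IsSmall f U

/-- The identifications `a ∼ f a`, for `a ∈ A`, on the disjoint union `X ⊕ Y`. -/
inductive AdjunctionRel {X : Type u} {Y : Type v} (A : Set X) (f : A → Y) : X ⊕ Y → X ⊕ Y → Prop
  | glue (a : A) : AdjunctionRel A f (Sum.inl a) (Sum.inr (f a))

/-- The adjunction space `X ∪_f Y`: the quotient of `X ⊕ Y` by the equivalence relation generated
by `a ∼ f a` for `a ∈ A`, with the quotient topology (both come with `Quot`). -/
abbrev AdjunctionSpace {X : Type u} {Y : Type v} (A : Set X) (f : A → Y) : Type (max u v) :=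
  Quot (AdjunctionRel A f)

open Set Function Topology

/-! Pull an open cover of the adjunction space back to `Y` and take a small partition of unity
there. Composed with `f` it is a partition of unity on `A`; if it extends over `X`, small for the
pulled-back cover and without raising the order, the two partitions glue on the quotient.

The extension is `AdmitsPartitions.exists_extension`. After a locally finite replacement, the
functions on `A` extend one at a time, with locally finite supports. This may raise the order, which
`exists_truncation` repairs without changing values on `A`. The sum is then known to be 1 only on
`A`, so `AdmitsPartitions.exists_partition_eq` blends in an auxiliary partition of `X`.

A bound `N : ℕ∞` treats both claims at once: `⊤` gives paracompactness, `n + 1` gives dimension.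
Hausdorffness comes last: points of the quotient are closed, and small partitions then separate
them. -/

theorem LocallyFinite.continuous_tsum {S : Type*} {X : Type*} [TopologicalSpace X] {d : S → X → ℝ}
    (hd : ∀ s, Continuous (d s)) (hl : LocallyFinite fun s => support (d s)) :
    Continuous fun x => ∑' s, d s x := by
  have h : (fun x => ∑' s, d s x) = fun x => ∑ᶠ s, d s x := by
    funext x
    exact tsum_eq_finsum (hl.point_finite x)
  rw [h]
  exact continuous_finsum hd hl

theorem LocallyFinite.summable {S : Type*} {X : Type*} [TopologicalSpace X] {d : S → X → ℝ}
    (hl : LocallyFinite fun s => support (d s)) (x : X) : Summable fun s => d s x :=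
  summable_of_hasFiniteSupport (hl.point_finite x)

theorem encard_ne_zero_le {S : Type*} {a b : S → ℝ} (h : ∀ s, b s = 0 → a s = 0) :
    {s | a s ≠ 0}.encard ≤ {s | b s ≠ 0}.encard :=
  encard_le_encard fun s hs hb => hs (h s hb)

/-! ### Locally finite replacement of partitions of unity. -/

namespace IsPartitionOfUnity

variable {S : Type*} {X : Type*} [TopologicalSpace X] {f : S → X → ℝ}

theorem le_one (hf : IsPartitionOfUnity f) (s : S) (x : X) : f s x ≤ 1 :=
  le_hasSum (hf.hasSum_one x) s fun t _ => hf.nonneg t x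

theorem exists_pos (hf : IsPartitionOfUnity f) (x : X) : ∃ s, 0 < f s x := by
  by_contra! h
  have h0 : (fun s => f s x) = fun _ => 0 := funext fun s => le_antisymm (h s) (hf.nonneg s x)
  have h1 := hf.hasSum_one x
  rw [h0] at h1
  exact zero_ne_one (hasSum_zero.unique h1)

theorem bddAbove (hf : IsPartitionOfUnity f) (x : X) : BddAbove (range fun s => f s x) :=
  ⟨1, by rintro _ ⟨s, rfl⟩; exact hf.le_one s x⟩

theorem le_iSup (hf : IsPartitionOfUnity f) (s : S) (x : X) : f s x ≤ ⨆ t, f t x :=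
  le_ciSup (hf.bddAbove x) s

/-- Near each point, all but finitely many members of a partition of unity are less than half of
a fixed member. -/
theorem exists_finset_eventually (hf : IsPartitionOfUnity f) (x : X) :
    ∃ (F : Finset S) (s₀ : S), s₀ ∈ F ∧
      ∀ᶠ y in 𝓝 x, 0 < f s₀ y ∧ ∀ s ∉ F, f s y < f s₀ y / 2 := by
  classical
  obtain ⟨s₀, hs₀⟩ := hf.exists_pos x
  -- With a quarter, each member outside `F` is below `f s₀ x / 4` near `x`, while `f s₀` stays
  -- above `f s₀ x / 2`.
  have h1 : ∀ᶠ F : Finset S in Filter.atTop, 1 - f s₀ x / 4 < ∑ s ∈ F, f s x :=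
    (hf.hasSum_one x).eventually_const_lt (by linarith)
  obtain ⟨F, hF, hsF⟩ := (h1.and (Filter.eventually_ge_atTop {s₀})).exists
  refine ⟨F, s₀, hsF (Finset.mem_singleton_self _), ?_⟩
  have h2 : ∀ᶠ y in 𝓝 x, 1 - f s₀ x / 4 < ∑ s ∈ F, f s y :=
    (continuous_finsetSum F fun s _ => hf.continuous s).continuousAt.eventually_const_lt hF
  have h3 : ∀ᶠ y in 𝓝 x, f s₀ x / 2 < f s₀ y :=
    (hf.continuous s₀).continuousAt.eventually_const_lt (by linarith)
  filter_upwards [h2, h3] with y h2 h3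
  refine ⟨by linarith, fun s hs => ?_⟩
  have h4 : ∑ t ∈ insert s F, f t y ≤ 1 :=
    sum_le_hasSum _ (fun t _ => hf.nonneg t y) (hf.hasSum_one y)
  rw [Finset.sum_insert hs] at h4
  linarith

theorem continuous_iSup (hf : IsPartitionOfUnity f) : Continuous fun x => ⨆ s, f s x := by
  rw [continuous_iff_continuousAt]
  intro x
  obtain ⟨F, s₀, hs₀, hF⟩ := hf.exists_finset_eventually x
  have hne : F.Nonempty := ⟨s₀, hs₀⟩
  have hc : Continuous fun y => F.sup' hne fun s => f s y :=
    Continuous.finset_sup'_apply hne fun s _ => hf.continuous s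
  refine hc.continuousAt.congr ?_
  filter_upwards [hF] with y hy
  have : Nonempty S := ⟨s₀⟩
  refine le_antisymm (Finset.sup'_le _ _ fun s _ => hf.le_iSup s y) (ciSup_le fun s => ?_)
  by_cases hs : s ∈ F
  · exact Finset.le_sup' (fun s => f s y) hs
  · exact le_trans (by linarith [hy.2 s hs, hy.1]) (Finset.le_sup' (fun s => f s y) hs₀)

/-- Dividing a locally finite nonnegative family by its (positive) sum gives a partition of
unity. -/
theorem of_normalize {d : S → X → ℝ} (hc : ∀ s, Continuous (d s)) (h0 : ∀ s x, 0 ≤ d s x)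
    (hl : LocallyFinite fun s => support (d s)) (hpos : ∀ x, ∃ s, 0 < d s x) :
    IsPartitionOfUnity fun s x => d s x / ∑' t, d t x := by
  have hp : ∀ x, 0 < ∑' t, d t x := fun x => by
    obtain ⟨s, hs⟩ := hpos x
    exact (hl.summable x).tsum_pos (fun t => h0 t x) s hs
  refine ⟨fun s => (hc s).div (hl.continuous_tsum hc) fun x => (hp x).ne',
    fun s x => div_nonneg (h0 s x) (hp x).le, fun x => ?_⟩
  have := (hl.summable x).hasSum.div_const (∑' t, d t x)
  rwa [div_self (hp x).ne'] at this

/-- Every partition of unity can be replaced by a locally finite one, whose members have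
their closed supports in the open supports of the given ones. -/
theorem exists_locallyFinite (hf : IsPartitionOfUnity f) :
    ∃ g : S → X → ℝ, IsPartitionOfUnity g ∧ (LocallyFinite fun s => support (g s)) ∧
      ∀ s, tsupport (g s) ⊆ support (f s) := by
  set M : X → ℝ := fun x => ⨆ s, f s x with hM
  have hM0 : ∀ x, 0 < M x := fun x => by
    obtain ⟨s, hs⟩ := hf.exists_pos x
    exact hs.trans_le (hf.le_iSup s x)
  -- Cutting at half the supremum leaves finitely many members near each point, and puts closed
  -- supports inside `{M / 2 ≤ f s}`, where `f s > 0`.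
  set d : S → X → ℝ := fun s x => max 0 (f s x - M x / 2) with hd
  have hc : ∀ s, Continuous (d s) := fun s =>
    continuous_const.max ((hf.continuous s).sub (hf.continuous_iSup.div_const 2))
  have hl : LocallyFinite fun s => support (d s) := by
    intro x
    obtain ⟨F, s₀, hs₀, hF⟩ := hf.exists_finset_eventually x
    refine ⟨_, hF, F.finite_toSet.subset ?_⟩
    rintro s ⟨y, hy, hy'⟩
    by_contra hs
    have h1 := hy'.2 s hs
    have h2 : f s₀ y ≤ M y := hf.le_iSup s₀ y
    exact hy (max_eq_left (by linarith))
  have hpos : ∀ x, ∃ s, 0 < d s x := fun x => by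
    have : Nonempty S := ⟨(hf.exists_pos x).choose⟩
    obtain ⟨s, hs⟩ := exists_lt_of_lt_ciSup (half_lt_self (hM0 x))
    exact ⟨s, lt_max_of_lt_right (sub_pos.2 hs)⟩
  refine ⟨_, of_normalize hc (fun s x => le_max_left _ _) hl hpos, ?_, ?_⟩
  · refine hl.subset fun s x hx => ?_
    exact fun h => hx (by simp only [h, zero_div])
  · intro s
    refine (closure_minimal (t := {x | M x / 2 ≤ f s x}) (fun x hx => ?_)
      (isClosed_le (hf.continuous_iSup.div_const 2) (hf.continuous s))).trans fun x hx => ?_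
    · by_contra hlt
      have hlt : f s x < M x / 2 := not_le.1 hlt
      have h : d s x = 0 := max_eq_left (by linarith)
      exact hx (by simp only [h, zero_div])
    · exact ((half_pos (hM0 x)).trans_le hx).ne'

end IsPartitionOfUnity

/-! ### Spaces with small partitions of bounded order. -/

/-- Every open cover of `X` admits a small partition of unity at each point of which at most `N`
members are nonzero. -/
def AdmitsPartitions (X : Type u) [TopologicalSpace X] (N : ℕ∞) : Prop :=
  ∀ (S : Type w) (U : S → Set X), (∀ s, IsOpen (U s)) → (⋃ s, U s) = univ →
    ∃ f : S → X → ℝ, IsPartitionOfUnity f ∧ (∀ x, {s | f s x ≠ 0}.encard ≤ N) ∧ IsSmall f U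

/-- Only the distinct members of a cover matter, and they form a set in the universe of `X`: choose
one index for each and put zero at all others. This is needed because covers of the adjunction space
may have indices in a larger universe. -/
theorem AdmitsPartitions.lift_universe {X : Type u} [TopologicalSpace X] {N : ℕ∞}
    (h : AdmitsPartitions.{u, u} X N) : AdmitsPartitions.{u, w} X N := by
  classical
  intro S U ho hU
  obtain ⟨g, hg, hN, hs⟩ := h (range U) (fun t => t.1) (by rintro ⟨_, s, rfl⟩; exact ho s)
    (by rw [← hU]; exact (sUnion_eq_iUnion (s := range U)).symm.trans (sUnion_range U))
  choose r hr using fun t : range U => t.2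
  have hri : Injective r := fun t t' htt => Subtype.ext (by rw [← hr t, ← hr t', htt])
  have hval : ∀ t, extend r g (0 : S → X → ℝ) (r t) = g t := fun t => hri.extend_apply g _ t
  have hout : ∀ s, s ∉ range r → extend r g (0 : S → X → ℝ) s = 0 := fun s hs =>
    extend_apply' g _ s hs
  refine ⟨extend r g (0 : S → X → ℝ), ⟨fun s => ?_, fun s x => ?_, fun x => ?_⟩, fun x => ?_, fun s x hx => ?_⟩
  · by_cases hs : s ∈ range r
    · obtain ⟨t, rfl⟩ := hs
      rw [hval]; exact hg.continuous t
    · rw [hout s hs]; exact continuous_zero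
  · by_cases hs : s ∈ range r
    · obtain ⟨t, rfl⟩ := hs
      rw [hval]; exact hg.nonneg t x
    · rw [hout s hs]; rfl
  · rw [← hri.hasSum_iff]
    · simpa only [comp_def, hval] using hg.hasSum_one x
    · intro s hs
      rw [hout s hs]; rfl
  · refine le_trans (le_trans (encard_le_encard ?_) (encard_image_le r _)) (hN x)
    intro s hsx
    by_cases hs : s ∈ range r
    · obtain ⟨t, rfl⟩ := hs
      refine ⟨t, ?_, rfl⟩
      have hsx : extend r g (0 : S → X → ℝ) (r t) x ≠ 0 := hsx
      rwa [hval] at hsx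
    · exact absurd (by rw [hout s hs]; rfl) hsx
  · by_cases h' : s ∈ range r
    · obtain ⟨t, rfl⟩ := h'
      rw [hval]
      rw [hr t] at hx
      exact hs t x hx
    · rw [hout s h']; rfl

theorem AdmitsPartitions.exists_locallyFinite {X : Type u} [TopologicalSpace X] {N : ℕ∞}
    (h : AdmitsPartitions.{u, u} X N) {S : Type w} {U : S → Set X} (ho : ∀ s, IsOpen (U s))
    (hU : (⋃ s, U s) = univ) :
    ∃ f : S → X → ℝ, IsPartitionOfUnity f ∧ (LocallyFinite fun s => support (f s)) ∧
      (∀ x, {s | f s x ≠ 0}.encard ≤ N) ∧ ∀ s, tsupport (f s) ⊆ U s := by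
  obtain ⟨f, hf, hN, hs⟩ := h.lift_universe S U ho hU
  obtain ⟨g, hg, hl, hgf⟩ := hf.exists_locallyFinite
  refine ⟨g, hg, hl, fun x => (encard_ne_zero_le fun s hs => ?_).trans (hN x),
    fun s => (hgf s).trans fun x hx => by_contra fun hx' => hx (hs s x hx')⟩
  exact image_eq_zero_of_notMem_tsupport fun h => hgf s h hs

theorem AdmitsPartitions.paracompactSpace {X : Type u} [TopologicalSpace X] {N : ℕ∞}
    (h : AdmitsPartitions.{u, u} X N) : ParacompactSpace X := by
  refine ⟨fun S U ho hU => ?_⟩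
  obtain ⟨f, hf, hl, -, hs⟩ := h.exists_locallyFinite ho hU
  refine ⟨S, fun s => support (f s), fun s => (hf.continuous s).isOpen_support, ?_, hl,
    fun s => ⟨s, (subset_tsupport _).trans (hs s)⟩⟩
  exact eq_univ_of_forall fun x => mem_iUnion.2 ((hf.exists_pos x).imp fun s hs => hs.ne')

/-- In a T₁ space whose open covers admit small partitions of unity, points can be separated. -/
theorem AdmitsPartitions.t2Space {X : Type u} [TopologicalSpace X] [T1Space X] {N : ℕ∞}
    (h : AdmitsPartitions.{u, u} X N) : T2Space X := by
  refine ⟨fun x y hxy => ?_⟩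
  obtain ⟨f, hf, -, hs⟩ := h.lift_universe Bool (fun b => if b then {x}ᶜ else {y}ᶜ)
    (by intro b; cases b <;> simp)
    (by
      refine eq_univ_of_forall fun z => mem_iUnion.2 ?_
      by_cases hz : z = x
      · exact ⟨false, by simpa [hz] using hxy⟩
      · exact ⟨true, by simpa using hz⟩)
  have hx : f true x = 0 := hs true x (by simp)
  have hy : f false y = 0 := hs false y (by simp)
  have hy1 : f true y = 1 := by
    have h1 := (hf.hasSum_one y).unique (hasSum_fintype _)
    simpa [hy] using h1.symm
  exact separated_by_continuous (hf.continuous true) (by rw [hx, hy1]; exact zero_ne_one)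

/-! ### Extending partitions of unity from a closed subset. -/

/-- A locally finite family of sets in a paracompact normal space expands to a locally
finite family of open sets. -/
theorem LocallyFinite.exists_isOpen_superset {S X : Type*} [TopologicalSpace X] [NormalSpace X]
    [ParacompactSpace X] {F : S → Set X} (hF : LocallyFinite F) :
    ∃ V : S → Set X, (∀ s, IsOpen (V s)) ∧ (∀ s, F s ⊆ V s) ∧ LocallyFinite V := by
  choose O hO hOF using hF
  obtain ⟨ρ, hρ⟩ := PartitionOfUnity.exists_isSubordinate (isClosed_univ (X := X))
    (fun x => interior (O x)) (fun x => isOpen_interior)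
    (fun x _ => mem_iUnion.2 ⟨x, mem_interior_iff_mem_nhds.2 (hO x)⟩)
  have hρl := ρ.locallyFinite_tsupport
  -- Remove from the space all closed supports that miss `F s`; each remaining support meets only
  -- finitely many `F s`.
  refine ⟨fun s => (⋃ j : {j // Disjoint (tsupport (ρ j)) (F s)}, tsupport (ρ j))ᶜ, fun s => ?_,
    fun s x hx => ?_, fun x => ?_⟩
  · exact ((hρl.comp_injective Subtype.val_injective).isClosed_iUnion
      fun j => isClosed_tsupport _).isOpen_compl
  · simp only [mem_compl_iff, mem_iUnion, not_exists]
    exact fun j hj => j.2.le_bot ⟨hj, hx⟩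
  · obtain ⟨t, ht, hfin⟩ := hρl x
    refine ⟨t, ht, (hfin.biUnion fun j _ => hOF j).subset ?_⟩
    rintro s ⟨y, hy, hyt⟩
    obtain ⟨j, hj⟩ := ρ.exists_pos (mem_univ y)
    have hyj : y ∈ tsupport (ρ j) := subset_tsupport _ hj.ne'
    simp only [mem_compl_iff, mem_iUnion, not_exists] at hy
    have hnd : ¬ Disjoint (tsupport (ρ j)) (F s) := fun hd => hy ⟨j, hd⟩ hyj
    obtain ⟨z, hz, hzF⟩ := not_disjoint_iff.1 hnd
    exact mem_biUnion (show j ∈ {i | (tsupport (ρ i) ∩ t).Nonempty} from ⟨y, hyj, hyt⟩)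
      ⟨z, hzF, interior_subset (hρ j hz)⟩

/-- A continuous function on a closed set `A` with values in `[0, 1]` extends to the whole space so
that it vanishes off a given open set containing the closure of its support. -/
theorem exists_extension_eq_zero_of_notMem {X : Type*} [TopologicalSpace X] [NormalSpace X]
    {A : Set X} (hA : IsClosed A) {h : A → ℝ} (hc : Continuous h) (h01 : ∀ a, h a ∈ Icc (0 : ℝ) 1)
    {V : Set X} (hV : IsOpen V) (hhV : Subtype.val '' tsupport h ⊆ V) :
    ∃ H : X → ℝ, Continuous H ∧ (∀ x, 0 ≤ H x) ∧ (∀ a : A, H a = h a) ∧ ∀ x ∉ V, H x = 0 := by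
  obtain ⟨G, hG, hGh⟩ := ContinuousMap.exists_restrict_eq_forall_mem_of_closed
    (⟨h, hc⟩ : C(A, ℝ)) (t := Icc 0 1) h01 ⟨0, by simp⟩ hA
  have hGa : ∀ a : A, G a = h a := fun a => DFunLike.congr_fun hGh a
  obtain ⟨u, hu0, hu1, hu⟩ := exists_continuous_zero_one_of_isClosed hV.isClosed_compl
    (hA.isClosedEmbedding_subtypeVal.isClosedMap _ (isClosed_tsupport h))
    (disjoint_compl_left_iff_subset.2 hhV)
  refine ⟨fun x => G x * u x, G.continuous.mul u.continuous,
    fun x => mul_nonneg (hG x).1 (hu x).1, fun a => ?_, fun x hx => ?_⟩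
  · by_cases ha : a ∈ tsupport h
    · simp [hGa, show u a = 1 from hu1 ⟨a, ha, rfl⟩]
    · simp [hGa, image_eq_zero_of_notMem_tsupport ha]
  · simp [show u x = 0 from hu0 hx]

/-- Every family of functions can be truncated, by subtracting a function that dominates all minima
of `k + 1` of its members, so that at most `k` members are nonzero at each point. -/
theorem exists_truncation {S X : Type*} [TopologicalSpace X] {A : Set X} {H : S → X → ℝ}
    (hc : ∀ s, Continuous (H s)) (h0 : ∀ s x, 0 ≤ H s x)
    (hl : LocallyFinite fun s => support (H s)) {N : ℕ∞}
    (hA : ∀ x ∈ A, {s | H s x ≠ 0}.encard ≤ N) :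
    ∃ K : S → X → ℝ, (∀ s, Continuous (K s)) ∧ (∀ s x, 0 ≤ K s x) ∧
      (∀ s x, H s x = 0 → K s x = 0) ∧ (∀ s, ∀ x ∈ A, K s x = H s x) ∧
      ∀ x, {s | K s x ≠ 0}.encard ≤ N := by
  induction N with
  | top => exact ⟨H, hc, h0, fun _ _ h => h, fun _ _ _ => rfl, fun _ => le_top⟩
  | coe k =>
  have hne : ∀ T : {T : Finset S // T.card = k + 1}, T.1.Nonempty := fun T =>
    Finset.card_pos.1 (by rw [T.2]; exact k.succ_pos)
  -- On `A` every such minimum vanishes. Elsewhere, among any `k + 1` members the least is at most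
  -- the sum `m` of all minima, so subtracting `m` kills it.
  set q : {T : Finset S // T.card = k + 1} → X → ℝ :=
    fun T x => T.1.inf' (hne T) fun s => H s x with hq
  have hqc : ∀ T, Continuous (q T) := fun T =>
    Continuous.finset_inf'_apply (hne T) fun s _ => hc s
  have hq0 : ∀ T x, 0 ≤ q T x := fun T x => Finset.le_inf' _ _ fun s _ => h0 s x
  have hqle : ∀ T x, ∀ s ∈ T.1, q T x ≤ H s x := fun T x s hs =>
    Finset.inf'_le (fun s => H s x) hs
  have hqn : ∀ T x, q T x ≠ 0 → ∀ s ∈ T.1, H s x ≠ 0 := fun T x hT s hs h =>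
    hT (le_antisymm (h ▸ hqle T x s hs) (hq0 T x))
  have hql : LocallyFinite fun T => support (q T) := by
    intro x
    obtain ⟨t, ht, hfin⟩ := hl x
    refine ⟨t, ht, Finite.of_finite_image (f := Subtype.val) ?_ Subtype.val_injective.injOn⟩
    refine hfin.toFinset.powerset.finite_toSet.subset ?_
    rintro _ ⟨T, ⟨y, hy, hyt⟩, rfl⟩
    refine Finset.mem_coe.2 (Finset.mem_powerset.2 fun s hs => ?_)
    exact hfin.mem_toFinset.2 ⟨y, hqn T y hy s hs, hyt⟩
  set m : X → ℝ := fun x => ∑' T, q T x with hm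
  have hmc : Continuous m := hql.continuous_tsum hqc
  have hm0 : ∀ x, 0 ≤ m x := fun x => tsum_nonneg fun T => hq0 T x
  have hmA : ∀ x ∈ A, m x = 0 := by
    intro x hx
    have : ∀ T, q T x = 0 := by
      intro T
      by_contra hT
      have h1 : (T.1 : Set S).encard ≤ k :=
        (encard_le_encard fun s hs => hqn T x hT s hs).trans (hA x hx)
      rw [encard_coe_eq_coe_finsetCard, T.2] at h1
      have := Nat.cast_le.1 h1
      omega
    simp [hm, this]
  refine ⟨fun s x => max 0 (H s x - m x), fun s => continuous_const.max ((hc s).sub hmc),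
    fun s x => le_max_left _ _, fun s x hx => max_eq_left (by linarith [hm0 x]),
    fun s x hx => by simp [hmA x hx, h0 s x], fun x => ?_⟩
  by_contra! hlt
  obtain ⟨T, hT, hTc⟩ := exists_subset_encard_eq (Order.add_one_le_of_lt hlt)
  have hTf : T.Finite := finite_of_encard_eq_coe (k := k + 1) (by simpa using hTc)
  lift T to Finset S using hTf
  rw [encard_coe_eq_coe_finsetCard] at hTc
  have hTk : T.card = k + 1 := by exact_mod_cast hTc
  obtain ⟨s, hs, hsq⟩ := Finset.exists_mem_eq_inf' (hne ⟨T, hTk⟩) fun s => H s x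
  have h1 : q ⟨T, hTk⟩ x ≤ m x := (hql.summable x).le_tsum _ fun T' _ => hq0 T' x
  have h2 : H s x ≤ m x := hsq ▸ h1
  exact hT hs (max_eq_left (by linarith))

/-- If `H` is a family on `X` whose sum is `σ`, small with respect to the open cover `U`, then there
is a partition of unity on `X`, small with respect to `U`, that agrees with `H` where `σ = 1`. -/
theorem AdmitsPartitions.exists_partition_eq {X : Type u} [TopologicalSpace X] {N : ℕ∞}
    (h : AdmitsPartitions.{u, u} X N) {S : Type w} {U : S → Set X} (ho : ∀ s, IsOpen (U s))
    (hU : (⋃ s, U s) = univ) {H : S → X → ℝ} (hc : ∀ s, Continuous (H s))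
    (h0 : ∀ s x, 0 ≤ H s x) {σ : X → ℝ} (hσ : Continuous σ)
    (hsum : ∀ x, HasSum (fun s => H s x) (σ x)) (hN : ∀ x, {s | H s x ≠ 0}.encard ≤ N)
    (hHU : IsSmall H U) :
    ∃ f : S → X → ℝ, IsPartitionOfUnity f ∧ (∀ x, {s | f s x ≠ 0}.encard ≤ N) ∧ IsSmall f U ∧
      ∀ x, σ x = 1 → ∀ s, f s x = H s x := by
  have hC : IsClosed {x | 1 / 2 ≤ σ x} := isClosed_le continuous_const hσ
  -- Where `1 / 2 ≤ σ`, only the supports of the `H s` are available, so the auxiliary partition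
  -- uses only indices with `H s x ≠ 0` and blending cannot raise the order.
  obtain ⟨k, hk, hkN, hks⟩ := h.lift_universe (S ⊕ S)
    (Sum.elim (fun s => support (H s)) fun s => U s \ {x | 1 / 2 ≤ σ x})
    (by
      rintro (s | s)
      · exact (hc s).isOpen_support
      · exact (ho s).sdiff hC)
    (by
      refine eq_univ_of_forall fun x => ?_
      by_cases hx : 1 / 2 ≤ σ x
      · have : ∃ s, H s x ≠ 0 := by
          by_contra! h'
          have h1 := hsum x
          simp only [h'] at h1
          have := h1.unique hasSum_zero
          linarith
        obtain ⟨s, hs⟩ := this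
        exact mem_iUnion.2 ⟨Sum.inl s, hs⟩
      · obtain ⟨s, hs⟩ := mem_iUnion.1 (hU ▸ mem_univ x : x ∈ ⋃ s, U s)
        exact mem_iUnion.2 ⟨Sum.inr s, hs, hx⟩)
  set p : S → X → ℝ := fun s x => k (Sum.inl s) x + k (Sum.inr s) x with hp
  have hpsum : ∀ x, HasSum (fun s => p s x) 1 := by
    intro x
    have h1 := (hk.hasSum_one x).summable
    have hl := (h1.comp_injective Sum.inl_injective).hasSum
    have hr := (h1.comp_injective Sum.inr_injective).hasSum
    have h2 := (hl.sum hr).unique (hk.hasSum_one x)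
    exact h2 ▸ hl.add hr
  have hpN : ∀ x, {s | p s x ≠ 0}.encard ≤ N := by
    intro x
    refine le_trans (le_trans (encard_le_encard ?_) (encard_image_le (Sum.elim id id) _)) (hkN x)
    intro s hs
    by_cases hl : k (Sum.inl s) x = 0
    · exact ⟨Sum.inr s, fun hr => hs (by simp [hp, hl, hr]), rfl⟩
    · exact ⟨Sum.inl s, hl, rfl⟩
  have hpH : ∀ x, 1 / 2 ≤ σ x → ∀ s, H s x = 0 → p s x = 0 := by
    intro x hx s hs
    have hl : k (Sum.inl s) x = 0 := hks _ x fun h' => h' hs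
    have hr : k (Sum.inr s) x = 0 := hks _ x fun h' => h'.2 hx
    simp [hp, hl, hr]
  have hpU : IsSmall p U := by
    intro s x hx
    have hl : k (Sum.inl s) x = 0 := hks _ x fun h' => h' (hHU s x hx)
    have hr : k (Sum.inr s) x = 0 := hks _ x fun h' => hx h'.1
    simp [hp, hl, hr]
  -- The blending weight is 0 where `σ ≤ 1 / 2` and 1 where `σ ≥ 1`.
  set t : X → ℝ := fun x => max 0 (min 1 (2 * σ x - 1)) with ht
  have htc : Continuous t := by fun_prop
  have ht0 : ∀ x, 0 ≤ t x := fun x => le_max_left _ _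
  have ht1 : ∀ x, t x ≤ 1 := fun x => max_le zero_le_one (min_le_left _ _)
  have htσ : ∀ x, ¬ 1 / 2 ≤ σ x → t x = 0 := fun x hx =>
    max_eq_left ((min_le_right _ _).trans (by linarith))
  have hd : ∀ x, 0 < max (σ x) (1 / 2) := fun x => lt_max_of_lt_right (by norm_num)
  refine ⟨fun s x => (1 - t x) * p s x + t x * (H s x / max (σ x) (1 / 2)),
    ⟨fun s => ?_, fun s x => ?_, fun x => ?_⟩, fun x => ?_, fun s x hx => ?_, fun x hx s => ?_⟩
  · have hpc : Continuous (p s) := (hk.continuous _).add (hk.continuous _)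
    exact ((continuous_const.sub htc).mul hpc).add
      (htc.mul ((hc s).div (hσ.max continuous_const) fun x => (hd x).ne'))
  · have hp0 : 0 ≤ p s x := add_nonneg (hk.nonneg _ x) (hk.nonneg _ x)
    exact add_nonneg (mul_nonneg (sub_nonneg.2 (ht1 x)) hp0)
      (mul_nonneg (ht0 x) (div_nonneg (h0 s x) (hd x).le))
  · have h1 := ((hpsum x).mul_left (1 - t x)).add
      (((hsum x).div_const (max (σ x) (1 / 2))).mul_left (t x))
    have h2 : (1 - t x) * 1 + t x * (σ x / max (σ x) (1 / 2)) = 1 := by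
      by_cases hx : 1 / 2 ≤ σ x
      · rw [max_eq_left hx, div_self (by linarith)]; ring
      · rw [htσ x hx]; ring
    rwa [h2] at h1
  · by_cases hx : 1 / 2 ≤ σ x
    · refine (encard_ne_zero_le fun s hH => ?_).trans (hN x)
      simp [hH, hpH x hx s hH]
    · refine (encard_ne_zero_le fun s hH => ?_).trans (hpN x)
      simp [hH, htσ x hx]
  · simp [hpU s x hx, hHU s x hx]
  · have : t x = 1 := by simp [ht, hx]; norm_num
    simp only [this, hx]
    norm_num

theorem LocallyFinite.image_subtypeVal {S X : Type*} [TopologicalSpace X] {A : Set X}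
    (hA : IsClosed A) {F : S → Set A} (hF : LocallyFinite F) :
    LocallyFinite fun s => Subtype.val '' F s := by
  intro x
  by_cases hx : x ∈ A
  · obtain ⟨t, ht, hfin⟩ := hF ⟨x, hx⟩
    obtain ⟨u, hu, hut⟩ := mem_nhds_subtype A ⟨x, hx⟩ t |>.1 ht
    refine ⟨u, hu, hfin.subset ?_⟩
    rintro s ⟨_, ⟨a, ha, rfl⟩, hau⟩
    exact ⟨a, ha, hut hau⟩
  · refine ⟨Aᶜ, hA.isOpen_compl.mem_nhds hx, finite_empty.subset ?_⟩
    rintro s ⟨_, ⟨a, ha, rfl⟩, hau⟩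
    exact hau a.2

/-- A locally finite partition of unity on a closed subset, small with respect to an open cover of
the whole space, extends to a small partition of unity. -/
theorem AdmitsPartitions.exists_extension {X : Type u} [TopologicalSpace X] [T2Space X] {N : ℕ∞}
    (hX : AdmitsPartitions.{u, u} X N) {A : Set X} (hA : IsClosed A) {S : Type w} {U : S → Set X}
    (ho : ∀ s, IsOpen (U s)) (hU : (⋃ s, U s) = univ) {h : S → A → ℝ} (hh : IsPartitionOfUnity h)
    (hl : LocallyFinite fun s => support (h s)) (hN : ∀ a, {s | h s a ≠ 0}.encard ≤ N)
    (hhU : ∀ s, Subtype.val '' tsupport (h s) ⊆ U s) :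
    ∃ f : S → X → ℝ, IsPartitionOfUnity f ∧ (∀ x, {s | f s x ≠ 0}.encard ≤ N) ∧ IsSmall f U ∧
      ∀ s (a : A), f s a = h s a := by
  have := hX.paracompactSpace
  obtain ⟨V, hVo, hV, hVl⟩ :=
    (LocallyFinite.image_subtypeVal hA hl.closure).exists_isOpen_superset
  choose H hHc hH0 hHA hHV using fun s => exists_extension_eq_zero_of_notMem hA (hh.continuous s)
    (fun a => ⟨hh.nonneg s a, hh.le_one s a⟩) ((hVo s).inter (ho s))
    (subset_inter (hV s) (hhU s))
  have hHl : LocallyFinite fun s => support (H s) := hVl.subset fun s x hx =>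
    by_contra fun hxV => hx (hHV s x fun h' => hxV h'.1)
  obtain ⟨K, hKc, hK0, hKH, hKA, hKN⟩ := exists_truncation (A := A) hHc hH0 hHl (N := N)
    (by intro x hx; simpa only [hHA _ ⟨x, hx⟩] using hN ⟨x, hx⟩)
  have hKl : LocallyFinite fun s => support (K s) := hHl.subset fun s x hx h' =>
    hx (hKH s x h')
  obtain ⟨f, hf, hfN, hfU, hfK⟩ := hX.exists_partition_eq ho hU hKc hK0 (hKl.continuous_tsum hKc)
    (fun x => (hKl.summable x).hasSum) hKN
    (fun s x hx => hKH s x (hHV s x fun h' => hx h'.2))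
  have hKh : ∀ s (a : A), K s a = h s a := fun s a => (hKA s a a.2).trans (hHA s a)
  refine ⟨f, hf, hfN, hfU, fun s a => (hfK a ?_ s).trans (hKh s a)⟩
  simp only [hKh]
  exact (hh.hasSum_one a).tsum_eq

/-! ### Closed points and gluing in the adjunction space. -/

namespace AdjunctionSpace

variable {X : Type u} {Y : Type v} {A : Set X} {f : A → Y}

open Classical in
/-- The preferred representative of the class of a point of `X ⊕ Y`: it lies in `Y` if possible. -/
noncomputable def representative (f : A → Y) : X ⊕ Y → X ⊕ Y :=
  Sum.elim (fun x => if h : x ∈ A then Sum.inr (f ⟨x, h⟩) else Sum.inl x) Sum.inr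

theorem mk_eq_mk_iff {p q : X ⊕ Y} :
    Quot.mk (AdjunctionRel A f) p = Quot.mk (AdjunctionRel A f) q ↔
      representative f p = representative f q := by
  have hmk : ∀ p, Quot.mk (AdjunctionRel A f) (representative f p) = Quot.mk _ p := by
    rintro (x | y)
    · by_cases hx : x ∈ A
      · simpa [representative, hx] using (Quot.sound (AdjunctionRel.glue (f := f) ⟨x, hx⟩)).symm
      · simp [representative, hx]
    · rfl
  refine ⟨fun h => ?_, fun h => by rw [← hmk p, h, hmk]⟩
  refine congrArg (Quot.lift (representative f) ?_) h
  rintro _ _ ⟨a⟩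
  simp [representative]

variable [TopologicalSpace X] [TopologicalSpace Y]

theorem t1Space [T1Space X] [T1Space Y] (hA : IsClosed A) (hf : Continuous f) :
    T1Space (AdjunctionSpace A f) := by
  refine ⟨fun z => ?_⟩
  obtain ⟨q, rfl⟩ := Quot.exists_rep z
  rw [← isQuotientMap_quot_mk.isClosed_preimage, isClosed_sum_iff]
  have hpre : Quot.mk (AdjunctionRel A f) ⁻¹' {Quot.mk _ q} =
      {p | representative f p = representative f q} := by
    ext p
    exact mk_eq_mk_iff
  rw [hpre]
  rcases representative f q with x₀ | y
  · constructor
    · refine Subsingleton.isClosed fun x hx x' hx' => ?_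
      have key : ∀ x, representative f (Sum.inl x) = Sum.inl x₀ → x = x₀ := by
        intro x hx
        by_cases h : x ∈ A <;> simp_all [representative]
      rw [key x hx, key x' hx']
    · exact Subsingleton.isClosed fun y hy => by cases hy
  · constructor
    · have : Sum.inl ⁻¹' {p | representative f p = Sum.inr y} = Subtype.val '' (f ⁻¹' {y}) := by
        ext x
        by_cases h : x ∈ A <;> simp [representative, h]
      rw [this]
      exact hA.isClosedEmbedding_subtypeVal.isClosedMap _ (isClosed_singleton.preimage hf)
    · have : Sum.inr ⁻¹' {p | representative f p = Sum.inr y} = {y} := by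
        ext y'
        simp [representative]
      rw [this]
      exact isClosed_singleton

theorem admitsPartitions [T2Space X] (hA : IsClosed A) (hf : Continuous f) {N : ℕ∞}
    (hX : AdmitsPartitions.{u, u} X N) (hY : AdmitsPartitions.{v, v} Y N) :
    AdmitsPartitions.{max u v, max u v} (AdjunctionSpace A f) N := by
  intro S U ho hU
  have hmk : Continuous (Quot.mk (AdjunctionRel A f)) := continuous_quot_mk
  set i : X → AdjunctionSpace A f := fun x => Quot.mk _ (Sum.inl x) with hi
  set j : Y → AdjunctionSpace A f := fun y => Quot.mk _ (Sum.inr y) with hj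
  have hic : Continuous i := hmk.comp continuous_inl
  have hjc : Continuous j := hmk.comp continuous_inr
  have hij : ∀ a : A, i a = j (f a) := fun a => Quot.sound (AdjunctionRel.glue a)
  obtain ⟨g, hg, hgl, hgN, hgU⟩ := hY.exists_locallyFinite (U := fun s => j ⁻¹' U s)
    (fun s => (ho s).preimage hjc) (by rw [← preimage_iUnion, hU, preimage_univ])
  obtain ⟨k, hk, hkN, hkU, hkg⟩ := hX.exists_extension hA (U := fun s => i ⁻¹' U s)
    (fun s => (ho s).preimage hic) (by rw [← preimage_iUnion, hU, preimage_univ])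
    (h := fun s a => g s (f a))
    ⟨fun s => (hg.continuous s).comp hf, fun s a => hg.nonneg s _, fun a => hg.hasSum_one _⟩
    (hgl.preimage_continuous hf) (fun a => hgN _)
    (by
      rintro s _ ⟨a, ha, rfl⟩
      have : f a ∈ tsupport (g s) := tsupport_comp_subset_preimage (g s) hf ha
      rw [mem_preimage, hij]
      exact hgU s this)
  refine ⟨fun s => Quot.lift (Sum.elim (k s) (g s)) ?_, ⟨fun s => ?_, fun s => ?_, ?_⟩, ?_,
    fun s => ?_⟩
  · rintro _ _ ⟨a⟩
    exact hkg s a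
  · exact continuous_quot_lift _ ((hk.continuous s).sumElim (hg.continuous s))
  · rintro ⟨x | y⟩
    exacts [hk.nonneg s x, hg.nonneg s y]
  · rintro ⟨x | y⟩
    exacts [hk.hasSum_one x, hg.hasSum_one y]
  · rintro ⟨x | y⟩
    exacts [hkN x, hgN y]
  · rintro ⟨x | y⟩ hz
    · exact hkU s x hz
    · exact image_eq_zero_of_notMem_tsupport (f := g s) fun h => hz (hgU s h)

end AdjunctionSpace

theorem isParacompactHausdorff_iff {X : Type u} [TopologicalSpace X] :
    IsParacompactHausdorff X ↔ T2Space X ∧ AdmitsPartitions.{u, u} X ⊤ := by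
  simp only [IsParacompactHausdorff, AdmitsPartitions, le_top, implies_true, true_and]

/-- For `n ≥ -1` the truncation `toNat` loses nothing; `n = -1` gives the bound 0. -/
theorem IsPartitionOfUnity.orderLE_iff {S : Type w} {X : Type u} [TopologicalSpace X]
    {f : S → X → ℝ} (hf : IsPartitionOfUnity f) {n : ℤ} (hn : -1 ≤ n) :
    OrderLE f n ↔ ∀ x, {s | f s x ≠ 0}.encard ≤ ((n + 1).toNat : ℕ∞) := by
  refine forall_congr' fun x => ?_
  have h : {s | 0 < f s x} = {s | f s x ≠ 0} := by
    ext s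
    exact (hf.nonneg s x).lt_iff_ne'
  rw [h, encard_le_coe_iff_finite_ncard_le]
  refine and_congr_right fun _ => ?_
  omega

theorem dimLE_iff {X : Type u} [TopologicalSpace X] {n : ℤ} (hn : -1 ≤ n) :
    DimLE X n ↔ T2Space X ∧ AdmitsPartitions.{u, u} X ((n + 1).toNat : ℕ∞) := by
  refine and_congr_right fun _ => forall₄_congr fun S U ho hU => exists_congr fun f => ?_
  refine and_congr_right fun hf => ?_
  rw [hf.orderLE_iff hn]

theorem proposition0p14 {X : Type u} {Y : Type v} [TopologicalSpace X] [TopologicalSpace Y]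
    (A : Set X) (hA : IsClosed A) (f : A → Y) (hf : Continuous f)
    (hX : IsParacompactHausdorff X) (hY : IsParacompactHausdorff Y) :
    IsParacompactHausdorff (AdjunctionSpace A f) ∧
      ∀ n : ℤ, -1 ≤ n → DimLE X n → DimLE Y n → DimLE (AdjunctionSpace A f) n := by
  rw [isParacompactHausdorff_iff] at *
  obtain ⟨_, hX⟩ := hX
  obtain ⟨_, hY⟩ := hY
  have : T1Space (AdjunctionSpace A f) := AdjunctionSpace.t1Space hA hf
  have hZ := AdjunctionSpace.admitsPartitions hA hf hX hY
  refine ⟨⟨hZ.t2Space, hZ⟩, fun n hn hXn hYn => ?_⟩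
  rw [dimLE_iff hn] at *
  exact ⟨hZ.t2Space, AdjunctionSpace.admitsPartitions hA hf hXn.2 hYn.2⟩
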